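/- \textbf{Conventions.} A \emph{directed set} is a preordered set $A$ in which any two elements have a common upper bound. A \emph{direct system} $X^*=\{X_a,p_{aa'},A\}$ in a category $\mathcal C$ consists of a directed set $A$, objects $X_a$ ($a\in A$) and morphisms $p_{aa'}:X_a\to X_{a'}$ for $a\le a'$ with $p_{aa}=1_{X_a}$ and $p_{a'a''}p_{aa'}=p_{aa''}$ for $a\le a'\le a''$. A \emph{morphism} $F=(f_a,f):X^*\to Y^*=\{Y_b,q_{bb'},B\}$ consists of an order-preserving function $f:A\to B$ and morphisms $f_a:X_a\to Y_{f(a)}$ in $\mathcal C$ with $q_{f(a)f(a')}f_a=f_{a'}p_{aa'}$ whenever $a\le a'$; the composite of $(f_a,f)$ and $(g_b,g)$ is $(g_{f(a)}f_a,\,g\circ f)$. These form the category $\text{dir-}\mathcal C$. Two morphisms $(f_a,f),(g_a,g):X^*\to Y^*$ are \emph{equivalent} if for each $a\in A$ there is $b\in B$ with $f(a),g(a)\le b$ and $q_{f(a)b}f_a=q_{g(a)b}g_a$; this is an equivalence relation compatible with composition, and $[F]$ denotes the class of $F$. Two direct systems $X^*,Y^*$ are \emph{equivalent} if there are morphisms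 $F:X^*\to Y^*$ and $G:Y^*\to X^*$ with $[GF]=[1_{X^*}]$ and $[FG]=[1_{Y^*}]$. Let $\mathrm{HCpt}^2$ be the category whose objects are the compact Hausdorff pairs $(X,X_0)$ ($X$ Hausdorff, $X_0\subseteq X$, both $X$ and $X_0$ compact) and whose morphisms are the homotopy classes of continuous maps of pairs $(X,X_0)\to(Y,Y_0)$, where a homotopy of maps of pairs must map $X_0$ into $Y_0$ at all times. In $\text{dir-}\mathrm{HCpt}^2$, equivalent morphisms are called \emph{homotopic}, written $F\simeq G$, and equivalent systems are called \emph{homotopy equivalent}, written $X^*\simeq Y^*$. Let $\mathcal G$ be the category of groups. Fix an abelian group $G$ and an integer $n\ge 0$. Homotopic maps of pairs induce the same homomorphism in relative singular homology $H_n(\,\cdot\,,\,\cdot\,;G)$, so there is a functor $H_n:\text{dir-}\mathrm{HCpt}^2\to\text{dir-}\mathcal G$ which sends $X^*=\{(X_a,X_{0a}),[p_{aa'}],A\}$ to $\{H_n(X_a,X_{0a};G),(p_{aa'})_n,A\}$ and $F=([f_a],f)$ to $((f_a)_n,f)$, where $(\cdot)_n$ denotes the induced homomorphism. \textbf{Theorem.}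 (1) If $F,F':X^*\to Y^*$ are homotopic morphisms in $\text{dir-}\mathrm{HCpt}^2$, then $H_n(F)$ and $H_n(F'):H_n(X^*)\to H_n(Y^*)$ are equivalent morphisms in $\text{dir-}\mathcal G$. (2) If $X^*\simeq Y^*$ in $\text{dir-}\mathrm{HCpt}^2$, then the direct systems of groups $H_n(X^*)$ and $H_n(Y^*)$ are equivalent. -/

import Mathlib

open CategoryTheory Limits

universe w v u v' u'

noncomputable section

namespace CHShape

/-! ## Direct systems in a category -/

/-- A direct system `{X_a, p_{aa'}, A}` in a category `C`: a directed (pre)ordered set `A` and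
a functor from `A`, regarded as a category with a unique arrow `a ⟶ a'` whenever `a ≤ a'`,
to `C`. -/
structure DirSystem (C : Type u) [Category.{v} C] where
  /-- The index set. -/
  Index : Type w
  [preorder : Preorder Index]
  [directed : IsDirected Index (· ≤ ·)]
  /-- The objects `X_a` and the transition morphisms `p_{aa'}`. -/
  diagram : Index ⥤ C

attribute [instance] DirSystem.preorder DirSystem.directed

namespace DirSystem

variable {C : Type u} [Category.{v} C] {D : Type u'} [Category.{v'} D]

/-- The object `X_a`. -/
abbrev obj (X : DirSystem.{w} C) (a : X.Index) : C := X.diagram.obj a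

/-- The transition morphism `p_{aa'}` for `a ≤ a'`. -/
abbrev trans (X : DirSystem.{w} C) {a a' : X.Index} (h : a ≤ a') : X.obj a ⟶ X.obj a' :=
  X.diagram.map (homOfLE h)

/-- A morphism `(f_a, f)` of direct systems. -/
@[ext]
structure Hom (X Y : DirSystem.{w} C) where
  /-- The order-preserving function between the index sets. -/
  idx : X.Index →o Y.Index
  /-- The morphisms `f_a : X_a ⟶ Y_{f(a)}`. -/
  app (a : X.Index) : X.obj a ⟶ Y.obj (idx a)
  comm {a a' : X.Index} (h : a ≤ a') :
    app a ≫ Y.trans (idx.monotone h) = X.trans h ≫ app a'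

/-- The category `dir-C` of direct systems in `C`. -/
instance category : Category (DirSystem.{w} C) where
  Hom X Y := Hom X Y
  id X :=
    { idx := OrderHom.id
      app := fun a => 𝟙 (X.obj a)
      comm := fun _ => (Category.id_comp _).trans (Category.comp_id _).symm }
  comp {X Y Z} F G :=
    { idx := G.idx.comp F.idx
      app := fun a => F.app a ≫ G.app (F.idx a)
      comm := fun {a a'} h => by
        have e : F.app a ≫ (G.app (F.idx a) ≫ Z.trans (G.idx.monotone (F.idx.monotone h))) =
            X.trans h ≫ (F.app a' ≫ G.app (F.idx a')) := by
          rw [G.comm (F.idx.monotone h), ← Category.assoc, F.comm h, Category.assoc]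
        exact (Category.assoc _ _ _).trans e }
  id_comp F := Hom.ext rfl (heq_of_eq (funext fun _ => Category.id_comp _))
  comp_id F := Hom.ext rfl (heq_of_eq (funext fun _ => Category.comp_id _))
  assoc F G H := Hom.ext rfl (heq_of_eq (funext fun _ => Category.assoc _ _ _))

theorem trans_trans (X : DirSystem.{w} C) {a b c : X.Index} (h : a ≤ b) (h' : b ≤ c) :
    X.trans h ≫ X.trans h' = X.trans (h.trans h') := by
  rw [trans, trans, ← Functor.map_comp]
  rfl

/-- Equivalence of morphisms of direct systems: `(f_a, f) ∼ (g_a, g)` if for every `a` there is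
`b` with `f(a), g(a) ≤ b` such that `q_{f(a)b} f_a = q_{g(a)b} g_a`. In the homotopy category
of compact Hausdorff pairs this is the relation `F ≃ G`. -/
def equivRel (C : Type u) [Category.{v} C] : HomRel (DirSystem.{w} C) := fun X Y F G =>
  ∀ a : X.Index, ∃ (b : Y.Index) (hf : F.idx a ≤ b) (hg : G.idx a ≤ b),
    F.app a ≫ Y.trans hf = G.app a ≫ Y.trans hg

instance equivRel_congruence : Congruence (equivRel.{w} C) where
  equivalence {X Y} :=
    { refl := fun F a => ⟨F.idx a, le_rfl, le_rfl, rfl⟩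
      symm := fun h a => by
        obtain ⟨b, hf, hg, e⟩ := h a
        exact ⟨b, hg, hf, e.symm⟩
      trans := fun {F G H} h h' a => by
        obtain ⟨b, hf, hg, e⟩ := h a
        obtain ⟨b', hg', hh, e'⟩ := h' a
        obtain ⟨c, hc, hc'⟩ := exists_ge_ge b b'
        refine ⟨c, hf.trans hc, hh.trans hc', ?_⟩
        rw [← Y.trans_trans hf hc, ← Category.assoc, e, Category.assoc, Y.trans_trans,
          ← Y.trans_trans hh hc', ← Category.assoc, ← e', Category.assoc, Y.trans_trans] }
  comp_left {X Y Z} F {G G'} h a := by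
    obtain ⟨b, hf, hg, e⟩ := h (F.idx a)
    exact ⟨b, hf, hg, (Category.assoc _ _ _).trans
      ((congrArg (F.app a ≫ ·) e).trans (Category.assoc _ _ _).symm)⟩
  comp_right {X Y Z} {F F'} G h a := by
    obtain ⟨b, hf, hg, e⟩ := h a
    have e' : F.app a ≫ (G.app (F.idx a) ≫ Z.trans (G.idx.monotone hf)) =
        F'.app a ≫ (G.app (F'.idx a) ≫ Z.trans (G.idx.monotone hg)) := by
      rw [G.comm hf, G.comm hg, ← Category.assoc, e, Category.assoc]
    exact ⟨G.idx b, G.idx.monotone hf, G.idx.monotone hg,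
      (Category.assoc _ _ _).trans (e'.trans (Category.assoc _ _ _).symm)⟩

/-- The category `Dir-C`: the same objects as `dir-C`, and equivalence classes of
morphisms. -/
abbrev Dir (C : Type u) [Category.{v} C] := CategoryTheory.Quotient (equivRel.{w} C)

/-- The functor `dir-C ⥤ Dir-C`, which sends a morphism `F` to its equivalence class `[F]`. -/
abbrev toDir (C : Type u) [Category.{v} C] : DirSystem.{w} C ⥤ Dir.{w} C :=
  CategoryTheory.Quotient.functor (equivRel.{w} C)

/-- Two direct systems are equivalent if there are morphisms `F : X ⟶ Y` and `G : Y ⟶ X` in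
`dir-C` with `[G F] = [1_X]` and `[F G] = [1_Y]`. For systems of compact Hausdorff pairs this
is the relation `X ≃ Y` of having the same homotopy type. -/
def Equivalent (X Y : DirSystem.{w} C) : Prop :=
  ∃ (F : X ⟶ Y) (G : Y ⟶ X),
    (toDir C).map (F ≫ G) = (toDir C).map (𝟙 X) ∧ (toDir C).map (G ≫ F) = (toDir C).map (𝟙 Y)

/-- The functor `dir-C ⥤ dir-D` that applies a functor `T : C ⥤ D` to all the objects and
morphisms of a direct system, and to all the components `f_a` of a morphism `(f_a, f)`. -/
def mapFunctor (T : C ⥤ D) : DirSystem.{w} C ⥤ DirSystem.{w} D where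
  obj X := { Index := X.Index, diagram := X.diagram ⋙ T }
  map {X Y} F :=
    { idx := F.idx
      app := fun a => T.map (F.app a)
      comm := fun {a a'} h => by
        change T.map (F.app a) ≫ T.map (Y.trans _) = T.map (X.trans _) ≫ T.map (F.app a')
        rw [← T.map_comp, ← T.map_comp, F.comm h] }
  map_id X := Hom.ext rfl (heq_of_eq (funext fun _ => T.map_id _))
  map_comp F G := Hom.ext rfl (heq_of_eq (funext fun _ => T.map_comp _ _))

end DirSystem

/-! ## The homotopy category of compact Hausdorff pairs -/

/-- The pairs `(X, X₀)` of spaces such that `X` is Hausdorff and `X`, `X₀` are compact. -/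
def isCompactHausdorff : ObjectProperty TopPair.{u} := fun X =>
  CompactSpace X.fst ∧ T2Space X.fst ∧ CompactSpace X.snd

/-- Compact Hausdorff pairs and continuous maps of pairs. -/
abbrev CHPair := isCompactHausdorff.{u}.FullSubcategory

/-- Homotopy of maps of pairs: since `Y₀ ⟶ Y` is an embedding, a homotopy of maps
`(X, X₀) ⟶ (Y, Y₀)` amounts to a homotopy of maps `X ⟶ Y` which maps `X₀` to `Y₀` at every
time. -/
def homotopyRel : HomRel CHPair.{u} := fun _ _ f g => TopPair.Homotopic f.hom g.hom

instance homotopyRel_congruence : Congruence homotopyRel.{u} where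
  equivalence := ⟨fun _ => TopPair.Homotopic.equivalence.refl _,
    fun h => TopPair.Homotopic.equivalence.symm h,
    fun h h' => TopPair.Homotopic.equivalence.trans h h'⟩
  comp_left f _ _ h := h.map fun H => H.comp (TopPair.Homotopy.refl f.hom)
  comp_right g h := h.map fun H => (TopPair.Homotopy.refl g.hom).comp H

/-- The category `HCpt²` of compact Hausdorff pairs and homotopy classes of maps of pairs. -/
abbrev HCpt2 := CategoryTheory.Quotient homotopyRel.{u}

/-! ## Relative singular homology -/

/-- The singular chain complex of a space, with coefficients in `G`. -/
abbrev singChains (G : AddCommGrpCat.{u}) : TopCat.{u} ⥤ ChainComplex AddCommGrpCat.{u} ℕ :=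
  (AlgebraicTopology.singularChainComplexFunctor AddCommGrpCat.{u}).obj G

/-- The relative singular chain complex `C(X; G) / C(X₀; G)` of a pair `(X, X₀)`. -/
def relChains (G : AddCommGrpCat.{u}) : TopPair.{u} ⥤ ChainComplex AddCommGrpCat.{u} ℕ where
  obj X := cokernel ((singChains G).map X.map)
  map {X Y} f := cokernel.map _ _ ((singChains G).map (TopPair.Hom.snd f))
    ((singChains G).map (TopPair.Hom.fst f)) (by
      rw [← Functor.map_comp, ← Functor.map_comp, TopPair.Hom.w])
  map_id X := by
    rw [← cancel_epi (cokernel.π _), cokernel.map, cokernel.π_desc]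
    change (singChains G).map (𝟙 X.fst) ≫ _ = _
    simp
  map_comp {X Y Z} f g := by
    rw [← cancel_epi (cokernel.π _), cokernel.map, cokernel.π_desc]
    change (singChains G).map (TopPair.Hom.fst f ≫ TopPair.Hom.fst g) ≫ _ = _
    simp

/-- The relative singular homology `H_n(X, X₀; G)`. -/
def relHomology (G : AddCommGrpCat.{u}) (n : ℕ) : TopPair.{u} ⥤ AddCommGrpCat.{u} :=
  relChains G ⋙ HomologicalComplex.homologyFunctor _ _ n

/-! ### Homotopic maps of pairs induce the same map in relative singular homology -/

theorem homologyMap_cokernelMap {V : Type u} [Category.{v} V] [Abelian V]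
    {A X B Y : ChainComplex V ℕ} (i : A ⟶ X) (j : B ⟶ Y) {g₀ g₁ : A ⟶ B} {f₀ f₁ : X ⟶ Y}
    (w₀ : i ≫ f₀ = g₀ ≫ j) (w₁ : i ≫ f₁ = g₁ ≫ j) (H : Homotopy f₀ f₁) (K : Homotopy g₀ g₁)
    (hc : ∀ p q, i.f p ≫ H.hom p q = K.hom p q ≫ j.f q) (n : ℕ) :
    HomologicalComplex.homologyMap (cokernel.map i j g₀ f₀ w₀) n =
      HomologicalComplex.homologyMap (cokernel.map i j g₁ f₁ w₁) n := by
  have hz : ∀ q, j.f q ≫ (cokernel.π j).f q = 0 := fun q => by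
    rw [← HomologicalComplex.comp_f, cokernel.condition, HomologicalComplex.zero_f]
  let hI : ∀ p, IsColimit (Cofork.ofπ (f := i.f p) (g := 0) ((cokernel.π i).f p) _) := fun p =>
    isColimitOfHasCokernelOfPreservesColimit (HomologicalComplex.eval V _ p) i
  have hs : ∀ p q, ∃ s : (cokernel i).X p ⟶ (cokernel j).X q,
      (cokernel.π i).f p ≫ s = H.hom p q ≫ (cokernel.π j).f q := fun p q =>
    ⟨(CokernelCofork.IsColimit.desc' (hI p) (H.hom p q ≫ (cokernel.π j).f q) (by
      rw [← Category.assoc, hc, Category.assoc, hz, comp_zero])).1,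
     (CokernelCofork.IsColimit.desc' (hI p) (H.hom p q ≫ (cokernel.π j).f q) _).2⟩
  choose s hs using hs
  have hepi : ∀ p, Epi ((cokernel.π i).f p) := fun p =>
    inferInstanceAs (Epi ((HomologicalComplex.eval V _ p).map (cokernel.π i)))
  refine Homotopy.homologyMap_eq (f := cokernel.map i j g₀ f₀ w₀)
    (g := cokernel.map i j g₁ f₁ w₁) { hom := s, zero := fun p q hpq => ?_, comm := fun p => ?_ } n
  · rw [← cancel_epi ((cokernel.π i).f p), hs, H.zero p q hpq, zero_comp, comp_zero]
  · have e : ∀ (g : A ⟶ B) (f : X ⟶ Y) (w : i ≫ f = g ≫ j),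
        (cokernel.π i).f p ≫ (cokernel.map i j g f w).f p = f.f p ≫ (cokernel.π j).f p := by
      intro g f w
      rw [← HomologicalComplex.comp_f, ← HomologicalComplex.comp_f, cokernel.map, cokernel.π_desc]
    rw [← cancel_epi ((cokernel.π i).f p), e, Preadditive.comp_add, Preadditive.comp_add, e,
      ← dNext_comp_left, ← prevD_comp_left, H.comm p, Preadditive.add_comp, Preadditive.add_comp,
      ← dNext_comp_right, ← prevD_comp_right]
    simp only [hs]

open MonoidalCategory Simplicial in
theorem toSimplicialHomotopy_natural {A B X Y : SSet.{u}} {i : A ⟶ X} {j : B ⟶ Y}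
    {f₀ f₁ : X ⟶ Y} {g₀ g₁ : A ⟶ B} (H : SSet.Homotopy f₀ f₁) (K : SSet.Homotopy g₀ g₁)
    (hc : i ▷ _ ≫ H.h = K.h ≫ j) {n : ℕ} (k : Fin (n + 1)) :
    i.app (.op ⦋n⦌) ≫ H.toSimplicialObjectHomotopy.h k =
      K.toSimplicialObjectHomotopy.h k ≫ j.app (.op ⦋n + 1⦌) := by
  ext x
  have e : (SSet.yonedaEquiv.symm (i.app (.op ⦋n⦌) x) ▷ Δ[1]) ≫ H.h =
      ((SSet.yonedaEquiv.symm x ▷ Δ[1]) ≫ K.h) ≫ j := by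
    rw [← SSet.yonedaEquiv_symm_comp, comp_whiskerRight, Category.assoc, hc, Category.assoc]
  exact ConcreteCategory.congr_hom (NatTrans.congr_app e _) _

open Simplicial in
theorem simplicialHom_natural {C : Type u} [Category.{v} C] [Preadditive C]
    {A B X Y : SimplicialObject C} {i : A ⟶ X} {j : B ⟶ Y} {f₀ f₁ : X ⟶ Y} {g₀ g₁ : A ⟶ B}
    (H : SimplicialObject.Homotopy f₀ f₁) (K : SimplicialObject.Homotopy g₀ g₁)
    (hc : ∀ (n : ℕ) (k : Fin (n + 1)), i.app (.op ⦋n⦌) ≫ H.h k = K.h k ≫ j.app (.op ⦋n + 1⦌))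
    (p q : ℕ) :
    i.app (.op ⦋p⦌) ≫ SimplicialObject.Homotopy.ToChainHomotopy.hom H p q =
      SimplicialObject.Homotopy.ToChainHomotopy.hom K p q ≫ j.app (.op ⦋q⦌) := by
  by_cases hpq : p + 1 = q
  · subst hpq
    simp [Preadditive.comp_sum, Preadditive.sum_comp, hc]
  · simp [SimplicialObject.Homotopy.ToChainHomotopy.hom_eq_zero, hpq]

theorem chainHomotopy_natural {A B X Y : SSet.{w}} {i : A ⟶ X} {j : B ⟶ Y}
    {f₀ f₁ : X ⟶ Y} {g₀ g₁ : A ⟶ B} (H : SSet.Homotopy f₀ f₁) (K : SSet.Homotopy g₀ g₁)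
    (hc : MonoidalCategoryStruct.whiskerRight i _ ≫ H.h = K.h ≫ j)
    {C : Type u} [Category.{v} C] [Preadditive C] [HasCoproducts.{w} C] (R : C) (p q : ℕ) :
    (SSet.chainComplexMap i R).f p ≫ (H.chainComplexMap R).hom p q =
      (K.chainComplexMap R).hom p q ≫ (SSet.chainComplexMap j R).f q := by
  refine simplicialHom_natural
    (i := ((SimplicialObject.whiskering _ _).obj (sigmaConst.obj R)).map i)
    (j := ((SimplicialObject.whiskering _ _).obj (sigmaConst.obj R)).map j)
    (H.toSimplicialObjectHomotopy.whiskerRight (sigmaConst.obj R))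
    (K.toSimplicialObjectHomotopy.whiskerRight (sigmaConst.obj R)) (fun n k => ?_) p q
  have := congrArg (sigmaConst.obj R).map (toSimplicialHomotopy_natural H K hc k)
  rw [Functor.map_comp, Functor.map_comp] at this
  exact this

theorem toSSet_natural {X Y : TopPair.{u}} {f g : X ⟶ Y} (H : TopPair.Homotopy f g) :
    MonoidalCategoryStruct.whiskerRight (TopCat.toSSet.map X.map) _ ≫ H.fst.toSSet.h =
      H.snd.toSSet.h ≫ TopCat.toSSet.map Y.map := by
  dsimp only [TopCat.Homotopy.toSSet]
  rw [← MonoidalCategory.whisker_exchange_assoc, Functor.LaxMonoidal.μ_natural_left_assoc,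
    Category.assoc, Category.assoc, ← Functor.map_comp, ← Functor.map_comp, H.w]

theorem relHomology_map_eq (G : AddCommGrpCat.{u}) (n : ℕ) {X Y : TopPair.{u}} {f g : X ⟶ Y}
    (h : TopPair.Homotopic f g) : (relHomology G n).map f = (relHomology G n).map g := by
  obtain ⟨H⟩ := h
  have hw : ∀ k : X ⟶ Y, (singChains G).map X.map ≫ (singChains G).map (TopPair.Hom.fst k) =
      (singChains G).map (TopPair.Hom.snd k) ≫ (singChains G).map Y.map := fun k => by
    rw [← Functor.map_comp, ← Functor.map_comp, TopPair.Hom.w]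
  exact homologyMap_cokernelMap _ _ (hw f) (hw g) (H.fst.singularChainComplexFunctorObjMap G)
    (H.snd.singularChainComplexFunctorObjMap G)
    (chainHomotopy_natural H.fst.toSSet H.snd.toSSet (toSSet_natural H) G) n

/-- The functor `(X, X₀) ↦ H_n(X, X₀; G)` from the homotopy category of compact Hausdorff pairs
to the category of groups. The homotopy class of `f` is sent to the homomorphism induced
by `f`. -/
def pairHomology (G : AddCommGrpCat.{u}) (n : ℕ) : HCpt2.{u} ⥤ GrpCat.{u} :=
  CategoryTheory.Quotient.lift homotopyRel.{u}
    (isCompactHausdorff.ι ⋙ relHomology G n ⋙ AddCommGrpCat.toCommGrp ⋙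
      forget₂ CommGrpCat GrpCat)
    (fun _ _ _ _ h => congrArg (AddCommGrpCat.toCommGrp ⋙ forget₂ CommGrpCat GrpCat).map
      (relHomology_map_eq G n h))

/-- The functor `H_n(-; G)` from direct systems in `HCpt²` to direct systems of groups:
`{(X_a, X₀_a), [p_{aa'}], A}` is sent to `{H_n(X_a, X₀_a; G), (p_{aa'})_n, A}`, and `([f_a], f)`
is sent to `((f_a)_n, f)`. -/
def systemHomology (G : AddCommGrpCat.{u}) (n : ℕ) :
    DirSystem.{w} HCpt2.{u} ⥤ DirSystem.{w} GrpCat.{u} :=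
  DirSystem.mapFunctor (pairHomology G n)

end CHShape

end

namespace CHShape.DirSystem

variable {C : Type u} [Category.{v} C] {D : Type u'} [Category.{v'} D]

/-! All the topology is already in `pairHomology`: homotopic maps of pairs agree on relative
homology (`relHomology_map_eq`), so homology descends to a functor on `HCpt2`. What remains is
formal and holds for every functor `T : C ⥤ D` applied levelwise. An equivalence of morphisms of
systems is, for each index, an equation between composites in `C`. Since `T` preserves composition,
it carries each such equation to `D`, which gives (1). Applying this to the two composites of
mutually inverse classes gives (2). -/

theorem equivRel_mapFunctor (T : C ⥤ D) {X Y : DirSystem.{w} C} {F F' : X ⟶ Y}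
    (h : equivRel.{w} C F F') :
    equivRel.{w} D ((mapFunctor T).map F) ((mapFunctor T).map F') := by
  intro a
  obtain ⟨b, hf, hg, e⟩ := h a
  -- `mapFunctor T` leaves index sets and index maps untouched, so the same `b` serves for the
  -- image.
  refine ⟨b, hf, hg, ?_⟩
  change T.map (F.app a) ≫ T.map (Y.trans hf) = T.map (F'.app a) ≫ T.map (Y.trans hg)
  rw [← T.map_comp, ← T.map_comp, e]

/-- Passing to the quotient identifies no more than `equivRel` does, because `equivRel` is a
congruence. Its transitivity is where directedness of the index set of `Y` enters. -/
theorem toDir_map_eq_iff {X Y : DirSystem.{w} C} (F F' : X ⟶ Y) :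
    (toDir C).map F = (toDir C).map F' ↔ equivRel.{w} C F F' :=
  CategoryTheory.Quotient.functor_map_eq_iff _ F F'

/-- The images of the two given morphisms are again inverse up to equivalence, since `mapFunctor T`
respects composites, identities and `equivRel`. -/
theorem Equivalent.mapFunctor (T : C ⥤ D) {X Y : DirSystem.{w} C} (h : X.Equivalent Y) :
    ((mapFunctor T).obj X).Equivalent ((mapFunctor T).obj Y) := by
  obtain ⟨F, F', h₁, h₂⟩ := h
  refine ⟨(DirSystem.mapFunctor T).map F, (DirSystem.mapFunctor T).map F', ?_, ?_⟩
  -- Both the composite and the identity are written as images under `mapFunctor T`, so that the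
  -- relation can be pulled back to `C`.
  · rw [← Functor.map_comp, ← (DirSystem.mapFunctor T).map_id, toDir_map_eq_iff]
    exact equivRel_mapFunctor T ((toDir_map_eq_iff _ _).1 h₁)
  · rw [← Functor.map_comp, ← (DirSystem.mapFunctor T).map_id, toDir_map_eq_iff]
    exact equivRel_mapFunctor T ((toDir_map_eq_iff _ _).1 h₂)

end CHShape.DirSystem

theorem mainTheorem11 (G : Type u) [AddCommGroup G] (n : ℕ) :
    (∀ (X Y : CHShape.DirSystem.{w} CHShape.HCpt2.{u}) (F F' : X ⟶ Y),
      CHShape.DirSystem.equivRel CHShape.HCpt2.{u} F F' →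
        CHShape.DirSystem.equivRel GrpCat.{u}
          ((CHShape.systemHomology (AddCommGrpCat.of G) n).map F)
          ((CHShape.systemHomology (AddCommGrpCat.of G) n).map F')) ∧
    (∀ X Y : CHShape.DirSystem.{w} CHShape.HCpt2.{u},
      X.Equivalent Y →
        ((CHShape.systemHomology (AddCommGrpCat.of G) n).obj X).Equivalent
          ((CHShape.systemHomology (AddCommGrpCat.of G) n).obj Y)) :=
  -- In both parts the functor left implicit is `pairHomology` with coefficients in `G` and degree
  -- `n`.
  ⟨fun _ _ _ _ h => CHShape.DirSystem.equivRel_mapFunctor _ h, fun _ _ h => h.mapFunctor _⟩
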